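/- Let $n\ge 1$ and let $\mathcal G$ be a weighted directed graph on $n$ nodes with adjacency matrix $(a_{ij})$, where $a_{ij}\ge 0$, $a_{ii}=0$, and $j$ is a neighbour of $i$ (written $j\in\mathcal N_i$) exactly when $a_{ij}>0$. Let $\mathcal L$ be its Laplacian, $l_{ii}=\sum_{k\ne i}a_{ik}$ and $l_{ij}=-a_{ij}$ for $j\neq i$. Let $C\in\mathbb R^{d\times d}$ have nonnegative diagonal entries, and suppose that $1$ is a semi-simple eigenvalue of $C$ of multiplicity $p\ge 1$ (algebraic and geometric multiplicity both equal $p$) and that every other complex eigenvalue of $C$ has real part less than $1$. List the eigenvalues with algebraic multiplicity as $\lambda_1(\mathcal L)=0,\lambda_2(\mathcal L),\dots,\lambda_n(\mathcal L)$ and $\lambda_1(C),\dots,\lambda_d(C)$. Consider on $t\ge 0$ the opinion dynamics $$\dot x_i=\sum_{j\in\mathcal N_i}a_{ij}\,C(x_j-x_i)+(C-I_d)x_i,\qquad x_i(t)\in\mathbb R^d,\quad i=1,\dots,n,$$ equivalently $\dot x=-\bigl(I_{nd}+(\mathcal L-I_n)\otimes C\bigr)x$ for the stacked vector $x$. The network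 is said to reach consensus exponentially fast if there are constants $K$ and $\alpha>0$ such that every solution satisfies $\|x_i(t)-x_j(t)\|\le Ke^{-\alpha t}\|x(0)\|$ for all $t\ge 0$ and all $i,j$. Then the network reaches consensus exponentially fast if and only if $$\operatorname{Re}\bigl((1-\lambda_i(\mathcal L))\,\lambda_k(C)\bigr)<1\qquad\text{for all } i\in\{2,\dots,n\},\ k\in\{1,\dots,d\}.$$ Moreover, suppose that this condition holds. Let $\gamma\in\mathbb R^n$ be the left eigenvector of $\mathcal L$ for the eigenvalue $0$ with $\sum_j\gamma_j=1$, and let $\zeta_1,\dots,\zeta_p$ and $\xi_1^\top,\dots,\xi_p^\top$ be real right and left eigenvectors of $C$ for the eigenvalue $1$ with $\xi_r^\top\zeta_s=\delta_{rs}$ for all $r,s$. Then every solution satisfies, for every $i$, $$\lim_{t\to\infty}x_i(t)=\Bigl(\sum_{r=1}^p\zeta_r\xi_r^\top\Bigr)\sum_{j=1}^n\gamma_j\,x_j(0),$$ and the convergence is exponential: there are constants $K$ and $\alpha>0$, independent of the solution, such that the distance of $x_i(t)$ to this limit is at most $Ke^{-\alpha t}\|x(0)\|$ for all $t\ge 0$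 and all $i$. -/

import Mathlib

open Filter Topology

noncomputable section

/-- A weighted directed graph on the nodes `0, …, n - 1`, given by its weighted adjacency matrix.
`adj i j` is the weight with which `i` takes the opinion of `j` into account; the edge from `j`
to `i` is present exactly when `adj i j > 0`. -/
structure WeightedDigraph (n : ℕ) where
  adj : Matrix (Fin n) (Fin n) ℝ
  adj_nonneg : ∀ i j, 0 ≤ adj i j
  adj_diag : ∀ i, adj i i = 0

namespace WeightedDigraph

variable {n : ℕ}

/-- There is an edge from `j` to `i`. -/
def Edge (G : WeightedDigraph n) (j i : Fin n) : Prop := 0 < G.adj i j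

open Classical in
/-- The set of (incoming) neighbours of `i`. -/
def neighbors (G : WeightedDigraph n) (i : Fin n) : Finset (Fin n) :=
  Finset.univ.filter fun j => G.Edge j i

/-- The Laplacian matrix: `l i i = ∑ k ≠ i, a i k` and `l i j = - a i j` for `j ≠ i`. -/
def laplacian (G : WeightedDigraph n) : Matrix (Fin n) (Fin n) ℝ :=
  Matrix.of fun i j => if i = j then ∑ k ∈ Finset.univ.erase i, G.adj i k else - G.adj i j

end WeightedDigraph

/-- `ev` lists the complex eigenvalues of the real matrix `M`, each one repeated according to its
algebraic multiplicity. -/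
def ListsEigenvalues {m : ℕ} (M : Matrix (Fin m) (Fin m) ℝ) (ev : Fin m → ℂ) : Prop :=
  Multiset.map ev Finset.univ.val = (M.map Complex.ofReal).charpoly.roots

/-- The standing assumption on the logic matrix `C`: the number `1` is a semi-simple eigenvalue of
multiplicity `p ≥ 1`, the other eigenvalues have real part less than `1`, and the diagonal entries
are nonnegative. -/
structure IsLogicMatrix {d : ℕ} (C : Matrix (Fin d) (Fin d) ℝ) (p : ℕ) : Prop where
  one_le : 1 ≤ p
  algebraic_mult : (C.map Complex.ofReal).charpoly.rootMultiplicity 1 = p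
  geometric_mult : Module.finrank ℂ (Module.End.eigenspace (C.map Complex.ofReal).toLin' 1) = p
  re_lt_one : ∀ z ∈ (C.map Complex.ofReal).charpoly.roots, z ≠ 1 → z.re < 1
  diag_nonneg : ∀ i, 0 ≤ C i i

/-- The opinions `x t i ∈ ℝᵈ` of the individuals `i` at the times `t ≥ 0` evolve according to
Model 1 with no stubborn individuals:
`ẋᵢ = ∑_{j ∈ Nᵢ} aᵢⱼ C (xⱼ - xᵢ) + (C - I) xᵢ` on `[0, ∞)` (one-sided derivative at `0`). -/
def IsModel1Solution {n d : ℕ} (G : WeightedDigraph n) (C : Matrix (Fin d) (Fin d) ℝ)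
    (x : ℝ → Fin n → EuclideanSpace ℝ (Fin d)) : Prop :=
  ∀ t, 0 ≤ t → ∀ i, HasDerivWithinAt (fun s => x s i)
    (∑ j ∈ G.neighbors i, G.adj i j • Matrix.toEuclideanLin C (x t j - x t i)
      + Matrix.toEuclideanLin (C - 1) (x t i)) (Set.Ici 0) t

/-- The network reaches a consensus on all topics exponentially fast: for every initial state, the
opinions of any two individuals approach each other at a common exponential rate.
(`‖x 0‖` is the largest of the Euclidean norms of the initial opinions.) -/
def ReachesConsensusExponentially {n d : ℕ} (G : WeightedDigraph n)
    (C : Matrix (Fin d) (Fin d) ℝ) : Prop :=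
  ∃ K α : ℝ, 0 < α ∧ ∀ x, IsModel1Solution G C x →
    ∀ t, 0 ≤ t → ∀ i j, ‖x t i - x t j‖ ≤ K * Real.exp (-α * t) * ‖x 0‖

end

/-!
Write `L` for the Laplacian. The stacked opinions, viewed as one complex vector, satisfy
`x' = ((1 - L) ⊗ C - 1) x`, whose generator has the eigenvalues `(1 - λᵢ) μₖ - 1`.

All decay statements come from one cascade argument that needs no Jordan form and no matrix
exponential. If `y' = B y` and `(B - s₁) ⋯ (B - sₘ) y = 0` with `Re sₖ < 0`, then each partial
product applied to `y` solves a scalar equation `u' = s u + f`, whose forcing term `f` is the next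
partial product, and so it decays if `f` does (`UniformExpDecay.of_deriv_eq_smul_add`,
`UniformExpDecay.of_shiftProd_mulVec`). Applied twice, first to the factors of `L` and then to those
of `C`, it shows that `L x` decays when `Re ((1 - λᵢ) μₖ) < 1` for `i ≠ 0`, because by Cayley–Hamilton
`∏ (L - λᵢ)`, over `i ≠ 0`, annihilates `L x` (`UniformExpDecay.of_commute`). As `1` is an eigenvalue
of `C`, the condition makes `0` a simple eigenvalue of `L`, so the kernel of `L` consists of the
constants and every matrix vanishing on constants is a left multiple of `L`
(`exists_eq_mul_of_ker_le`). Hence the differences of opinions decay, and so does the deviation from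
the mean `γᵀ x` (`uniformExpDecay_deviation`).

Conversely, each `λᵢ` with `i ≠ 0` has a nonconstant eigenvector; for `λᵢ = 0` this uses that, by the
maximum principle, a nonzero constant is not in the range of `L`. Its tensor product with an
eigenvector of `C` gives an explicit solution without consensus if `Re ((1 - λᵢ) μₖ) ≥ 1`
(`re_lt_of_reachesConsensusExponentially`).

For the limit, the mean `γᵀ x` follows `w' = (C - 1) w`. With `P = ∑ ζᵣ ξᵣᵀ` the vector `P w` is
conserved, and `(1 - P) w` decays since semisimplicity of the eigenvalue `1` makes the product of
the other factors of `C` annihilate `1 - P` (`shiftProd_mul_one_sub_projector`).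
-/

open Matrix
open scoped Kronecker

/-! ### Uniform exponential decay of families of functions -/

/-- The functions `f a`, indexed by `a : A`, decay exponentially on `[0, ∞)`, with a common rate
and with constants proportional to the weights `w a`. In the application, `a` runs through the
solutions of an equation and `w a` is the size of the initial value. -/
def UniformExpDecay {A E : Type*} [Norm E] (w : A → ℝ) (f : A → ℝ → E) : Prop :=
  ∃ K α : ℝ, 0 ≤ K ∧ 0 < α ∧ ∀ a t, 0 ≤ t → ‖f a t‖ ≤ K * Real.exp (-α * t) * w a

namespace UniformExpDecay

variable {A E F : Type*} {w : A → ℝ}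

lemma zero [NormedAddCommGroup E] (w : A → ℝ) : UniformExpDecay w (fun _ _ => (0 : E)) :=
  ⟨0, 1, le_rfl, one_pos, by simp⟩

lemma congr [Norm E] {f g : A → ℝ → E} (hf : UniformExpDecay w f)
    (h : ∀ a t, 0 ≤ t → g a t = f a t) : UniformExpDecay w g := by
  obtain ⟨K, α, hK, hα, H⟩ := hf
  exact ⟨K, α, hK, hα, fun a t ht => by rw [h a t ht]; exact H a t ht⟩

lemma add [NormedAddCommGroup E] (hw : ∀ a, 0 ≤ w a) {f g : A → ℝ → E}
    (hf : UniformExpDecay w f) (hg : UniformExpDecay w g) :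
    UniformExpDecay w (fun a t => f a t + g a t) := by
  obtain ⟨K, α, hK, hα, hf⟩ := hf
  obtain ⟨M, β, hM, hβ, hg⟩ := hg
  refine ⟨K + M, min α β, by positivity, by positivity, fun a t ht => ?_⟩
  have h1 : Real.exp (-α * t) ≤ Real.exp (-min α β * t) := by
    gcongr; exact min_le_left _ _
  have h2 : Real.exp (-β * t) ≤ Real.exp (-min α β * t) := by
    gcongr; exact min_le_right _ _
  have hwa := hw a
  calc ‖f a t + g a t‖ ≤ K * Real.exp (-α * t) * w a + M * Real.exp (-β * t) * w a :=
        (norm_add_le _ _).trans (add_le_add (hf a t ht) (hg a t ht))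
    _ ≤ K * Real.exp (-min α β * t) * w a + M * Real.exp (-min α β * t) * w a := by gcongr
    _ = _ := by ring

lemma linearMap [NormedAddCommGroup E] [NormedAddCommGroup F] [NormedSpace ℝ E] [NormedSpace ℝ F]
    [FiniteDimensional ℝ E] {f : A → ℝ → E} (hf : UniformExpDecay w f) (T : E →ₗ[ℝ] F) :
    UniformExpDecay w (fun a t => T (f a t)) := by
  obtain ⟨K, α, hK, hα, hf⟩ := hf
  refine ⟨‖LinearMap.toContinuousLinearMap T‖ * K, α, by positivity, hα, fun a t ht => ?_⟩
  calc ‖T (f a t)‖ ≤ ‖LinearMap.toContinuousLinearMap T‖ * ‖f a t‖ :=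
        (LinearMap.toContinuousLinearMap T).le_opNorm _
    _ ≤ ‖LinearMap.toContinuousLinearMap T‖ * (K * Real.exp (-α * t) * w a) := by
        gcongr; exact hf a t ht
    _ = _ := by ring

lemma mulVec {ι κ : Type*} [Fintype ι] [Fintype κ] {f : A → ℝ → ι → ℂ}
    (hf : UniformExpDecay w f) (B : Matrix κ ι ℂ) :
    UniformExpDecay w (fun a t => B.mulVec (f a t)) :=
  hf.linearMap (B.mulVecLin.restrictScalars ℝ)

/-- A scalar equation `y' = s y + f` with `Re s < 0` and an exponentially decaying forcing term has
exponentially decaying solutions: the derivative of `exp (-s t) y` is `exp (-s t) f`, whose norm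
is dominated by that of an explicit exponential. -/
lemma of_deriv_eq_smul_add [NormedAddCommGroup E] [NormedSpace ℂ E] (hw : ∀ a, 0 ≤ w a)
    {y f : A → ℝ → E} {s : ℂ} (hs : s.re < 0) (hf : UniformExpDecay w f)
    (h0 : ∃ K, 0 ≤ K ∧ ∀ a, ‖y a 0‖ ≤ K * w a)
    (hy : ∀ a t, 0 ≤ t → HasDerivWithinAt (y a) (s • y a t + f a t) (Set.Ici 0) t) :
    UniformExpDecay w y := by
  obtain ⟨K, α, hK, hα, hf⟩ := hf
  obtain ⟨K₀, hK₀, h0⟩ := h0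
  -- Half the rate `-Re s` is given away so that `c` is strictly positive.
  set β := min α (-s.re / 2) with hβ
  have hβ0 : 0 < β := lt_min hα (by linarith)
  have hβα : β ≤ α := min_le_left _ _
  have hβs : β ≤ -s.re / 2 := min_le_right _ _
  set c := -s.re - β with hc
  have hc0 : 0 < c := by linarith
  refine ⟨K₀ + K / c, β, by positivity, hβ0, fun a t ht => ?_⟩
  have hwa := hw a
  set u : ℝ → E := fun τ : ℝ => Complex.exp (-s * τ) • y a τ with hu
  have hder : ∀ τ : ℝ, 0 ≤ τ →
      HasDerivWithinAt u (Complex.exp (-s * τ) • f a τ) (Set.Ici 0) τ := by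
    intro τ hτ
    have h1 : HasDerivAt (fun τ : ℝ => Complex.exp (-s * τ)) (Complex.exp (-s * τ) * (-s)) τ := by
      have := (((hasDerivAt_id (τ : ℂ)).const_mul (-s)).cexp).comp_ofReal
      simpa using this
    have h2 := h1.hasDerivWithinAt.smul (hy a τ hτ) (s := Set.Ici 0)
    refine h2.congr_deriv ?_
    rw [smul_add, smul_smul, add_right_comm, ← add_smul]
    simp [mul_comm]
  have hnexp : ∀ τ : ℝ, ‖Complex.exp (-s * τ)‖ = Real.exp (-s.re * τ) := by
    intro τ; simp [Complex.norm_exp]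
  have hbound : ‖u t‖ ≤ K₀ * w a + K * w a * ((Real.exp (c * t) - 1) / c) := by
    refine image_norm_le_of_norm_deriv_right_le_deriv_boundary (a := 0) (b := t)
      (f := u) (f' := fun τ : ℝ => Complex.exp (-s * τ) • f a τ)
      (B := fun τ => K₀ * w a + K * w a * ((Real.exp (c * τ) - 1) / c))
      (B' := fun τ => K * w a * Real.exp (c * τ)) ?_ ?_ ?_ ?_ ?_ ⟨ht, le_rfl⟩
    · intro τ hτ
      exact (hder τ hτ.1).continuousWithinAt.mono Set.Icc_subset_Ici_self
    · intro τ hτ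
      exact (hder τ hτ.1).mono (Set.Ici_subset_Ici.2 hτ.1)
    · simpa [hu] using h0 a
    · intro τ
      have h1 : HasDerivAt (fun τ : ℝ => Real.exp (c * τ)) (Real.exp (c * τ) * c) τ := by
        simpa using ((hasDerivAt_id τ).const_mul c).exp
      refine ((((h1.sub_const 1).div_const c).const_mul (K * w a)).const_add (K₀ * w a)).congr_deriv
        ?_
      field_simp
    · intro τ hτ
      rw [norm_smul, hnexp]
      calc Real.exp (-s.re * τ) * ‖f a τ‖
          ≤ Real.exp (-s.re * τ) * (K * Real.exp (-α * τ) * w a) := by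
            gcongr; exact hf a τ hτ.1
        _ ≤ Real.exp (-s.re * τ) * (K * Real.exp (-β * τ) * w a) := by
            have := hτ.1
            gcongr
        _ = K * w a * (Real.exp (-s.re * τ) * Real.exp (-β * τ)) := by ring
        _ = K * w a * Real.exp (c * τ) := by
            rw [← Real.exp_add]; congr 2; rw [hc]; ring
  have hyu : ‖y a t‖ = Real.exp (s.re * t) * ‖u t‖ := by
    rw [hu, norm_smul, hnexp, ← mul_assoc, ← Real.exp_add]
    simp
  have e1 : Real.exp (s.re * t) ≤ Real.exp (-β * t) := by
    gcongr; linarith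
  have e2 : Real.exp (s.re * t) * Real.exp (c * t) = Real.exp (-β * t) := by
    rw [← Real.exp_add]; congr 1; rw [hc]; ring
  calc ‖y a t‖ ≤ Real.exp (s.re * t) * (K₀ * w a + K * w a * ((Real.exp (c * t) - 1) / c)) := by
        rw [hyu]; gcongr
    _ ≤ Real.exp (s.re * t) * (K₀ * w a + K * w a * (Real.exp (c * t) / c)) := by
        gcongr; linarith
    _ = K₀ * w a * Real.exp (s.re * t)
          + K * w a / c * (Real.exp (s.re * t) * Real.exp (c * t)) := by ring
    _ ≤ K₀ * w a * Real.exp (-β * t) + K * w a / c * Real.exp (-β * t) := by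
        rw [e2]; gcongr
    _ = _ := by ring

end UniformExpDecay

/-! ### Linear systems with a prescribed annihilating product -/

section Cascade


variable {A ι : Type*} {w : A → ℝ} [Fintype ι]

lemma HasDerivWithinAt.mulVec {κ : Type*} [Fintype κ] {y : ℝ → ι → ℂ} {y' : ι → ℂ} {S : Set ℝ}
    {t : ℝ} (hy : HasDerivWithinAt y y' S t) (B : Matrix κ ι ℂ) :
    HasDerivWithinAt (fun t => B *ᵥ y t) (B *ᵥ y') S t :=
  (LinearMap.toContinuousLinearMap
    (B.mulVecLin.restrictScalars ℝ)).hasFDerivAt.comp_hasDerivWithinAt t hy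

lemma exists_norm_mulVec_le {κ : Type*} [Fintype κ] (B : Matrix κ ι ℂ) {y : A → ι → ℂ}
    (hy : ∃ K, 0 ≤ K ∧ ∀ a, ‖y a‖ ≤ K * w a) : ∃ K, 0 ≤ K ∧ ∀ a, ‖B *ᵥ y a‖ ≤ K * w a := by
  obtain ⟨K, hK, hy⟩ := hy
  let T := LinearMap.toContinuousLinearMap (B.mulVecLin.restrictScalars ℝ)
  refine ⟨‖T‖ * K, by positivity, fun a => (T.le_opNorm (y a)).trans ?_⟩
  rw [mul_assoc]
  gcongr
  exact hy a

/-- The product `(B - s₁) ⋯ (B - sₘ)` in a complex algebra, for `s₁, …, sₘ` in the list `l`. -/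
def shiftProd {R : Type*} [Ring R] [Algebra ℂ R] (B : R) (l : List ℂ) : R :=
  (l.map fun s => B - algebraMap ℂ R s).prod

section shiftProd

variable {R : Type*} [Ring R] [Algebra ℂ R]

@[simp] lemma shiftProd_nil (B : R) : shiftProd B [] = 1 := by simp [shiftProd]

@[simp] lemma shiftProd_cons (B : R) (s : ℂ) (l : List ℂ) :
    shiftProd B (s :: l) = (B - algebraMap ℂ R s) * shiftProd B l := by simp [shiftProd]

lemma shiftProd_eq_aeval (B : R) (l : List ℂ) :
    shiftProd B l =
      Polynomial.aeval B (l.map fun s => Polynomial.X - Polynomial.C s).prod := by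
  simp [shiftProd, map_list_prod, Function.comp_def]

lemma Commute.shiftProd_right {B D : R} (h : Commute D B) (l : List ℂ) :
    Commute D (shiftProd B l) := by
  induction l with
  | nil => simp
  | cons s l ih =>
    rw [shiftProd_cons]
    exact (h.sub_right (Algebra.commutes s D).symm).mul_right ih

lemma shiftProd_smul_sub (B : R) (m e : ℂ) (l : List ℂ) :
    shiftProd (m • B - algebraMap ℂ R e) (l.map fun μ => m * μ - e) =
      m ^ l.length • shiftProd B l := by
  induction l with
  | nil => simp
  | cons s l ih =>
    rw [List.map_cons, shiftProd_cons, ih, shiftProd_cons, List.length_cons, pow_succ', mul_smul,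
      mul_smul_comm, ← smul_mul_assoc, ← smul_mul_assoc, ← smul_mul_assoc, smul_comm]
    congr 2
    simp [Algebra.algebraMap_eq_smul_one, smul_sub, sub_smul, mul_smul]

end shiftProd

variable [DecidableEq ι]

/-- Cascade argument for `y' = B y + f` with decaying `f`: if `(B - s₁) ⋯ (B - sₘ) y` decays and
all `sₖ` have negative real part, then `y` decays, since each partial product applied to `y` solves
a scalar equation whose forcing term is the next one. -/
lemma UniformExpDecay.of_shiftProd_mulVec (hw : ∀ a, 0 ≤ w a) (B : Matrix ι ι ℂ) (l : List ℂ)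
    (hl : ∀ s ∈ l, s.re < 0) {y f : A → ℝ → ι → ℂ} (hf : UniformExpDecay w f)
    (h0 : ∃ K, 0 ≤ K ∧ ∀ a, ‖y a 0‖ ≤ K * w a)
    (hy : ∀ a t, 0 ≤ t → HasDerivWithinAt (y a) (B *ᵥ y a t + f a t) (Set.Ici 0) t)
    (h : UniformExpDecay w fun a t => shiftProd B l *ᵥ y a t) : UniformExpDecay w y := by
  induction l with
  | nil => simpa using h
  | cons s l ih =>
    refine ih (fun r hr => hl r (List.mem_cons_of_mem _ hr)) ?_
    refine UniformExpDecay.of_deriv_eq_smul_add hw (hl s List.mem_cons_self)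
      (h.add hw (hf.mulVec (shiftProd B l))) (exists_norm_mulVec_le _ h0) fun a t ht => ?_
    refine ((hy a t ht).mulVec (shiftProd B l)).congr_deriv ?_
    rw [mulVec_add, mulVec_mulVec, ← ((Commute.refl B).shiftProd_right l).eq, shiftProd_cons,
      sub_mul, sub_mulVec, Algebra.algebraMap_eq_smul_one, smul_mul_assoc, one_mul, smul_mulVec]
    abel

/-- If `M` and `N` commute, `(M - m₁) ⋯ (M - mᵣ)` annihilates the solution `y` of `y' = (M N - 1) y`,
`(N - μ₁) ⋯ (N - μₛ) = 0` and all products `mᵢ μₖ` have real part less than `1`, then `y` decays: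
modulo `M - m` the equation is `y' = (m N - 1) y`. -/
lemma UniformExpDecay.of_commute (hw : ∀ a, 0 ≤ w a) {M N : Matrix ι ι ℂ} (hMN : Commute M N)
    (l k : List ℂ) (hlk : ∀ m ∈ l, ∀ μ ∈ k, (m * μ).re < 1) (hN : shiftProd N k = 0)
    {y : A → ℝ → ι → ℂ} (h0 : ∃ K, 0 ≤ K ∧ ∀ a, ‖y a 0‖ ≤ K * w a)
    (hy : ∀ a t, 0 ≤ t → HasDerivWithinAt (y a) ((M * N - 1) *ᵥ y a t) (Set.Ici 0) t)
    (h : UniformExpDecay w fun a t => shiftProd M l *ᵥ y a t) : UniformExpDecay w y := by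
  induction l with
  | nil => simpa using h
  | cons m l ih =>
    refine ih (fun r hr => hlk r (List.mem_cons_of_mem _ hr)) ?_
    refine UniformExpDecay.of_shiftProd_mulVec hw (m • N - 1) (k.map fun μ => m * μ - 1) ?_
      (h.mulVec N) (exists_norm_mulVec_le _ h0) (fun a t ht => ?_) ?_
    · intro s hs
      obtain ⟨μ, hμ, rfl⟩ := List.mem_map.1 hs
      have := hlk m List.mem_cons_self μ hμ
      simpa using this
    · refine ((hy a t ht).mulVec (shiftProd M l)).congr_deriv ?_
      have hc : shiftProd M l * (M * N - 1) = (M * N - 1) * shiftProd M l :=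
        (((Commute.refl M).mul_left hMN.symm).sub_left (Commute.one_left M)).shiftProd_right l
          |>.eq.symm
      rw [mulVec_mulVec, hc, mulVec_mulVec, mulVec_mulVec, ← add_mulVec, shiftProd_cons,
        ← mul_assoc N, ← add_mul, mul_sub, Algebra.algebraMap_eq_smul_one, mul_smul_comm, mul_one,
        ← hMN.eq]
      congr 2
      abel
    · have := shiftProd_smul_sub N m 1 k
      rw [map_one, hN, smul_zero] at this
      simp only [this, zero_mulVec]
      exact UniformExpDecay.zero w

end Cascade

/-! ### Annihilating products and spectral projectors of matrices -/

section Spectral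

lemma sub_kronecker {l m n p : Type*} (A B : Matrix l m ℂ) (D : Matrix n p ℂ) :
    (A - B) ⊗ₖ D = A ⊗ₖ D - B ⊗ₖ D := by
  ext; simp [sub_mul]

lemma kronecker_sub {l m n p : Type*} (D : Matrix l m ℂ) (A B : Matrix n p ℂ) :
    D ⊗ₖ (A - B) = D ⊗ₖ A - D ⊗ₖ B := by
  ext; simp [mul_sub]

variable {ι κ : Type*} [Fintype ι] [DecidableEq ι] [Fintype κ] [DecidableEq κ]

lemma shiftProd_append {R : Type*} [Ring R] [Algebra ℂ R] (B : R) (l k : List ℂ) :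
    shiftProd B (l ++ k) = shiftProd B l * shiftProd B k := by simp [shiftProd]

lemma shiftProd_replicate {R : Type*} [Ring R] [Algebra ℂ R] (B : R) (s : ℂ) (p : ℕ) :
    shiftProd B (List.replicate p s) = (B - algebraMap ℂ R s) ^ p := by simp [shiftProd]

/-- Cayley–Hamilton for the list of the roots of the characteristic polynomial. -/
lemma shiftProd_charpoly_roots (B : Matrix ι ι ℂ) {l : List ℂ}
    (hl : (l : Multiset ℂ) = B.charpoly.roots) : shiftProd B l = 0 := by
  rw [shiftProd_eq_aeval]
  have h := (IsAlgClosed.splits B.charpoly).eq_prod_roots_of_monic B.charpoly_monic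
  rw [← hl, Multiset.map_coe, Multiset.prod_coe] at h
  rw [← h, B.aeval_self_charpoly]

lemma shiftProd_kronecker_one (B : Matrix ι ι ℂ) (l : List ℂ) :
    shiftProd (B ⊗ₖ (1 : Matrix κ κ ℂ)) l = shiftProd B l ⊗ₖ 1 := by
  induction l with
  | nil => simp
  | cons s l ih =>
    rw [shiftProd_cons, ih, shiftProd_cons]
    conv_rhs => rw [← mul_one (1 : Matrix κ κ ℂ), mul_kronecker_mul]
    congr 1
    rw [Algebra.algebraMap_eq_smul_one, Algebra.algebraMap_eq_smul_one, sub_kronecker,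
      smul_kronecker, one_kronecker_one]

lemma shiftProd_one_kronecker (B : Matrix κ κ ℂ) (l : List ℂ) :
    shiftProd ((1 : Matrix ι ι ℂ) ⊗ₖ B) l = 1 ⊗ₖ shiftProd B l := by
  induction l with
  | nil => simp
  | cons s l ih =>
    rw [shiftProd_cons, ih, shiftProd_cons]
    conv_rhs => rw [← mul_one (1 : Matrix ι ι ℂ), mul_kronecker_mul]
    congr 1
    rw [Algebra.algebraMap_eq_smul_one, Algebra.algebraMap_eq_smul_one, kronecker_sub,
      kronecker_smul, one_kronecker_one]

/-- If `L Q = 0` with `Q = (L - s₁) ⋯ (L - sₘ)` and all `sₖ ≠ 0`, then every matrix that vanishes on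
the kernel of `L` is a left multiple of `L`: modulo `L`, the product `Q` is a nonzero scalar. -/
lemma exists_eq_mul_of_ker_le (L D : Matrix ι ι ℂ) (l : List ℂ) (hl : ∀ s ∈ l, s ≠ 0)
    (hL : L * shiftProd L l = 0) (hD : ∀ v, L *ᵥ v = 0 → D *ᵥ v = 0) : ∃ R, D = R * L := by
  have hDQ : D * shiftProd L l = 0 := by
    refine ext_of_mulVec_single fun i => ?_
    rw [← mulVec_mulVec, zero_mulVec]
    exact hD _ (by rw [mulVec_mulVec, hL, zero_mulVec])
  have key : ∀ k : List ℂ, (∀ s ∈ k, s ≠ 0) → ∃ (c : ℂ) (H : Matrix ι ι ℂ), c ≠ 0 ∧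
      shiftProd L k = c • 1 + H * L := by
    intro k
    induction k with
    | nil => exact fun _ => ⟨1, 0, one_ne_zero, by simp⟩
    | cons s k ih =>
      intro hk
      obtain ⟨c, H, hc, hH⟩ := ih fun r hr => hk r (List.mem_cons_of_mem _ hr)
      refine ⟨-s * c, c • 1 + (L - s • 1) * H,
        mul_ne_zero (neg_ne_zero.2 (hk s List.mem_cons_self)) hc, ?_⟩
      rw [shiftProd_cons, hH, Algebra.algebraMap_eq_smul_one]
      simp only [sub_mul, mul_add, add_mul, smul_mul_assoc, mul_smul_comm, one_mul, mul_one,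
        mul_assoc, neg_smul, mul_smul, neg_mul]
      module
  obtain ⟨c, H, hc, hH⟩ := key l hl
  refine ⟨-c⁻¹ • (D * H), ?_⟩
  rw [hH, mul_add, mul_smul_comm, mul_one, ← mul_assoc] at hDQ
  rw [smul_mul_assoc, ← neg_eq_of_add_eq_zero_right hDQ, smul_neg, neg_smul, neg_neg, smul_smul,
    inv_mul_cancel₀ hc, one_smul]

/-- The projector `∑ ζᵣ ξᵣᵀ` onto a semisimple eigenspace: if `ζ` and `ξ` are biorthogonal right and
left eigenvectors for an eigenvalue `e` of algebraic and geometric multiplicity `p`, then the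
product of the factors `C - μ` over the other eigenvalues `μ` annihilates `1 - ∑ ζᵣ ξᵣᵀ`. -/
lemma shiftProd_mul_one_sub_projector {p : ℕ} (C : Matrix ι ι ℂ) (e : ℂ)
    (halg : C.charpoly.rootMultiplicity e = p)
    (hgeo : Module.finrank ℂ (Module.End.eigenspace C.toLin' e) = p)
    (ζ ξ : Fin p → ι → ℂ) (hζ : ∀ r, C *ᵥ ζ r = e • ζ r)
    (hξζ : ∀ r s, ξ r ⬝ᵥ ζ s = if r = s then 1 else 0)
    (hPC : (∑ r, vecMulVec (ζ r) (ξ r)) * C = e • ∑ r, vecMulVec (ζ r) (ξ r)) :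
    shiftProd C (C.charpoly.roots.filter (· ≠ e)).toList * (1 - ∑ r, vecMulVec (ζ r) (ξ r)) = 0 := by
  set P := ∑ r, vecMulVec (ζ r) (ξ r) with hP
  set l := (C.charpoly.roots.filter (· ≠ e)).toList with hl
  set Q := shiftProd C l with hQ
  have hPζ : ∀ s, P *ᵥ ζ s = ζ s := by
    intro s
    simp [hP, sum_mulVec, vecMulVec_mulVec, hξζ]
  have hCP : C * P = e • P := by
    rw [hP, Finset.mul_sum, Finset.smul_sum]
    refine Finset.sum_congr rfl fun r _ => ?_
    rw [mul_vecMulVec, hζ, smul_vecMulVec]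
  have hpow : (C - algebraMap ℂ _ e) ^ p * Q = 0 := by
    rw [hQ, ← shiftProd_replicate, ← shiftProd_append]
    refine shiftProd_charpoly_roots C ?_
    rw [← Multiset.coe_add, hl, Multiset.coe_toList, Multiset.coe_replicate, ← halg,
      ← Polynomial.count_roots, ← Multiset.filter_eq', Multiset.filter_add_not]
  have hspan : ∀ v, C *ᵥ v = e • v → P *ᵥ v = v := by
    intro v hv
    have hli : LinearIndependent ℂ ζ := by
      rw [Fintype.linearIndependent_iff]
      intro g hg r
      have := congrArg (fun u => ξ r ⬝ᵥ u) hg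
      simpa [dotProduct_sum, hξζ] using this
    have hsp : Submodule.span ℂ (Set.range ζ) = Module.End.eigenspace C.toLin' e := by
      refine Submodule.eq_of_le_of_finrank_eq ?_ ?_
      · rw [Submodule.span_le]
        rintro _ ⟨r, rfl⟩
        exact Module.End.mem_eigenspace_iff.2 (by simpa using hζ r)
      · rw [finrank_span_eq_card hli, hgeo, Fintype.card_fin]
    have hle : Submodule.span ℂ (Set.range ζ) ≤ LinearMap.eqLocus P.mulVecLin LinearMap.id := by
      rw [Submodule.span_le]
      rintro _ ⟨r, rfl⟩
      exact hPζ r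
    exact hle (hsp ▸ Module.End.mem_eigenspace_iff.2 (by simpa using hv))
  have hmax : Module.End.eigenspace C.toLin' e = Module.End.maxGenEigenspace C.toLin' e := by
    refine Submodule.eq_of_le_of_finrank_eq (Module.End.genEigenspace_le_maximal _ _ 1) ?_
    rw [hgeo, LinearMap.finrank_maxGenEigenspace_eq, charpoly_toLin', halg]
  have hPQ : P * Q = Q := by
    refine ext_of_mulVec_single fun i => ?_
    rw [← mulVec_mulVec]
    refine hspan _ ?_
    have : Q *ᵥ Pi.single i 1 ∈ Module.End.maxGenEigenspace C.toLin' e := by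
      refine (Module.End.mem_maxGenEigenspace _ _ _).2 ⟨p, ?_⟩
      have h1 : C.toLin' - e • (1 : Module.End ℂ (ι → ℂ)) =
          toLin' (C - algebraMap ℂ (Matrix ι ι ℂ) e) := by
        rw [map_sub, Algebra.algebraMap_eq_smul_one, map_smul, toLin'_one]; rfl
      rw [h1, ← toLin'_pow, toLin'_apply, mulVec_mulVec, hpow, zero_mulVec]
    rw [← hmax] at this
    simpa using Module.End.mem_eigenspace_iff.1 this
  have hcomm : Commute P (shiftProd C l) :=
    Commute.shiftProd_right (show P * C = C * P by rw [hPC, hCP]) l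
  rw [mul_sub, mul_one, ← hcomm.eq, hPQ, sub_self]

end Spectral

/-! ### The Laplacian -/

namespace WeightedDigraph

variable {n : ℕ}

/-- The Laplacian as a complex matrix. -/
def complexLaplacian (G : WeightedDigraph n) : Matrix (Fin n) (Fin n) ℂ :=
  G.laplacian.map Complex.ofReal

lemma complexLaplacian_mulVec_apply (G : WeightedDigraph n) (v : Fin n → ℂ) (i : Fin n) :
    (G.complexLaplacian *ᵥ v) i = ∑ j, (G.adj i j : ℂ) * (v i - v j) := by
  have h : ∀ j, (G.complexLaplacian i j) * v j =
      (if i = j then (∑ k, (G.adj i k : ℂ)) * v i else 0) - G.adj i j * v j := by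
    intro j
    by_cases hij : i = j
    · subst hij
      simp [complexLaplacian, laplacian, G.adj_diag]
    · simp [complexLaplacian, laplacian, hij]
  simp only [mulVec, dotProduct, h, Finset.sum_sub_distrib, mul_sub, Finset.sum_ite_eq,
    Finset.mem_univ, if_true, Finset.sum_mul]

lemma complexLaplacian_mulVec_const (G : WeightedDigraph n) (c : ℂ) :
    G.complexLaplacian *ᵥ (fun _ => c) = 0 := by
  ext i
  simp [complexLaplacian_mulVec_apply]

/-- A nonzero constant vector is not in the range of the Laplacian: at a node where a real vector is
minimal, its image under the Laplacian is nonpositive. -/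
lemma eq_zero_of_complexLaplacian_mulVec_eq_const [NeZero n] (G : WeightedDigraph n)
    {v : Fin n → ℂ} {c : ℂ} (h : G.complexLaplacian *ᵥ v = fun _ => c) : c = 0 := by
  by_contra hc
  obtain ⟨i, hi⟩ := Finite.exists_min fun j => (v j / c).re
  have h1 := congrFun h i
  rw [complexLaplacian_mulVec_apply] at h1
  have h2 : ∑ j, (G.adj i j : ℂ) * (v i / c - v j / c) = 1 := by
    rw [← div_self hc, ← h1, Finset.sum_div]
    refine Finset.sum_congr rfl fun j _ => ?_
    ring
  have h3 := congrArg Complex.re h2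
  simp only [Complex.re_sum, Complex.re_ofReal_mul, Complex.sub_re, Complex.one_re] at h3
  have h4 : ∑ j, G.adj i j * ((v i / c).re - (v j / c).re) ≤ 0 :=
    Finset.sum_nonpos fun j _ =>
      mul_nonpos_of_nonneg_of_nonpos (G.adj_nonneg i j) (sub_nonpos.2 (hi j))
  linarith

/-- The listed eigenvalues of index other than `0`, with their multiplicities; the eigenvalue of index
`0` is the distinguished eigenvalue `0` of the Laplacian. -/
noncomputable def otherEigenvalues [NeZero n] (ev : Fin n → ℂ) : List ℂ :=
  ((Finset.univ.erase (0 : Fin n)).toList).map ev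

lemma mem_otherEigenvalues [NeZero n] {ev : Fin n → ℂ} {s : ℂ} :
    s ∈ otherEigenvalues ev ↔ ∃ i, i ≠ 0 ∧ ev i = s := by
  simp [otherEigenvalues]

variable [NeZero n] {G : WeightedDigraph n} {ev : Fin n → ℂ}

lemma cons_otherEigenvalues (hev : ListsEigenvalues G.laplacian ev) (hev0 : ev 0 = 0) :
    ((0 :: otherEigenvalues ev : List ℂ) : Multiset ℂ) = G.complexLaplacian.charpoly.roots := by
  rw [complexLaplacian, ← hev, ← Multiset.cons_coe, otherEigenvalues, ← Multiset.map_coe,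
    Finset.coe_toList]
  nth_rw 1 [← hev0]
  rw [← Multiset.map_cons, Finset.erase_val, Multiset.cons_erase (Finset.mem_univ_val _)]

lemma rootMultiplicity_zero (hev : ListsEigenvalues G.laplacian ev) (hev0 : ev 0 = 0) :
    G.complexLaplacian.charpoly.rootMultiplicity 0 = (otherEigenvalues ev).count 0 + 1 := by
  rw [← Polynomial.count_roots, ← cons_otherEigenvalues hev hev0, Multiset.coe_count,
    List.count_cons_self]

lemma complexLaplacian_mul_shiftProd (hev : ListsEigenvalues G.laplacian ev) (hev0 : ev 0 = 0) :
    G.complexLaplacian * shiftProd G.complexLaplacian (otherEigenvalues ev) = 0 := by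
  have := shiftProd_charpoly_roots _ (cons_otherEigenvalues hev hev0)
  simpa using this

/-- If `0` is a simple eigenvalue of the Laplacian, then its kernel consists of the constants. -/
lemma exists_eq_const_of_mulVec_eq_zero (hev : ListsEigenvalues G.laplacian ev) (hev0 : ev 0 = 0)
    (hne : ∀ s ∈ otherEigenvalues ev, s ≠ 0) {v : Fin n → ℂ} (hv : G.complexLaplacian *ᵥ v = 0) :
    ∃ c : ℂ, v = fun _ => c := by
  have hone : (1 : Fin n → ℂ) ≠ 0 := one_ne_zero
  have hsp : Submodule.span ℂ {(1 : Fin n → ℂ)} =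
      Module.End.eigenspace G.complexLaplacian.toLin' 0 := by
    refine Submodule.eq_of_le_of_finrank_le ?_ ?_
    · rw [Submodule.span_singleton_le_iff_mem, Module.End.mem_eigenspace_iff, zero_smul]
      exact G.complexLaplacian_mulVec_const 1
    · rw [finrank_span_singleton hone]
      refine (LinearMap.finrank_eigenspace_le _ _).trans ?_
      rw [charpoly_toLin', rootMultiplicity_zero hev hev0,
        List.count_eq_zero_of_not_mem fun h => hne 0 h rfl]
  have hmem : v ∈ Submodule.span ℂ {(1 : Fin n → ℂ)} := by
    rw [hsp, Module.End.mem_eigenspace_iff, zero_smul]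
    exact hv
  obtain ⟨c, rfl⟩ := Submodule.mem_span_singleton.1 hmem
  exact ⟨c, by ext; simp⟩

/-- Each listed eigenvalue of the Laplacian other than the distinguished `0` has a nonconstant
eigenvector. If that eigenvalue is `0` as well, the algebraic multiplicity of `0` is at least `2`; were
the kernel reduced to the constants, so would be the generalized eigenspace of `0`, since no nonzero
constant is in the range. -/
lemma exists_nonconstant_eigenvector (hev : ListsEigenvalues G.laplacian ev) (hev0 : ev 0 = 0)
    {s : ℂ} (hs : s ∈ otherEigenvalues ev) :
    ∃ v : Fin n → ℂ, G.complexLaplacian *ᵥ v = s • v ∧ ∃ a b, v a ≠ v b := by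
  by_cases hs0 : s = 0
  · subst hs0
    by_contra! hcon
    have hker : ∀ v : Fin n → ℂ, G.complexLaplacian *ᵥ v = 0 → v = fun _ => v 0 := by
      intro v hv
      funext a
      exact hcon v (by rw [hv, zero_smul]) a 0
    have hpow : ∀ (k : ℕ) (v : Fin n → ℂ), (G.complexLaplacian ^ k) *ᵥ v = 0 → v = fun _ => v 0 := by
      intro k
      induction k with
      | zero =>
        intro v hv
        rw [pow_zero, one_mulVec] at hv
        subst hv
        rfl
      | succ k ih =>
        intro v hv
        rw [pow_succ, ← mulVec_mulVec] at hv
        have h1 := ih _ hv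
        refine hker v ?_
        rw [h1, G.eq_zero_of_complexLaplacian_mulVec_eq_const h1]
        rfl
    have hle : Module.End.maxGenEigenspace G.complexLaplacian.toLin' 0 ≤
        Submodule.span ℂ {(1 : Fin n → ℂ)} := by
      intro v hv
      obtain ⟨k, hk⟩ := (Module.End.mem_maxGenEigenspace _ _ _).1 hv
      rw [zero_smul, sub_zero, ← toLin'_pow, toLin'_apply] at hk
      rw [hpow k v hk]
      exact Submodule.mem_span_singleton.2 ⟨v 0, by ext; simp⟩
    have h1 := Submodule.finrank_mono hle
    rw [LinearMap.finrank_maxGenEigenspace_eq, charpoly_toLin', rootMultiplicity_zero hev hev0,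
      finrank_span_singleton one_ne_zero] at h1
    have := List.count_pos_iff.2 hs
    omega
  · have hroot : s ∈ G.complexLaplacian.charpoly.roots := by
      rw [← cons_otherEigenvalues hev hev0]
      exact List.mem_cons_of_mem _ hs
    have hE : Module.End.HasEigenvalue G.complexLaplacian.toLin' s := by
      rw [Module.End.hasEigenvalue_iff_isRoot_charpoly, charpoly_toLin']
      exact Polynomial.isRoot_of_mem_roots hroot
    obtain ⟨v, hv⟩ := hE.exists_hasEigenvector
    have hv1 : G.complexLaplacian *ᵥ v = s • v := by simpa using hv.apply_eq_smul
    refine ⟨v, hv1, ?_⟩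
    by_contra! hconst
    have h0 := G.complexLaplacian_mulVec_const (v 0)
    rw [show (fun _ => v 0) = v from funext fun a => hconst 0 a, hv1] at h0
    exact (smul_ne_zero hs0 hv.2) h0

end WeightedDigraph

/-! ### Complexification of the opinion dynamics -/

section Dynamics

variable {n d : ℕ}

/-- The opinions of all individuals on all topics as one complex vector. -/
noncomputable def complexify :
    (Fin n → EuclideanSpace ℝ (Fin d)) →ₗ[ℝ] (Fin n × Fin d → ℂ) where
  toFun X q := (X q.1 q.2 : ℂ)
  map_add' X Y := by ext q; simp
  map_smul' c X := by ext q; simp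

/-- The entrywise real part, a left inverse of `complexify`. -/
noncomputable def rePart :
    (Fin n × Fin d → ℂ) →ₗ[ℝ] (Fin n → EuclideanSpace ℝ (Fin d)) where
  toFun z i := WithLp.toLp 2 fun l => (z (i, l)).re
  map_add' X Y := by ext i l; simp
  map_smul' c X := by ext i l; simp

@[simp] lemma complexify_apply (X : Fin n → EuclideanSpace ℝ (Fin d)) (q : Fin n × Fin d) :
    complexify X q = (X q.1 q.2 : ℂ) := rfl

@[simp] lemma rePart_apply (z : Fin n × Fin d → ℂ) (i : Fin n) (l : Fin d) :
    rePart z i l = (z (i, l)).re := rfl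

@[simp] lemma rePart_complexify (X : Fin n → EuclideanSpace ℝ (Fin d)) :
    rePart (complexify X) = X := by
  ext i l; simp

/-- The matrix `(1 - L) ⊗ C - 1` of the complexified dynamics. -/
noncomputable def systemMatrix (G : WeightedDigraph n) (C : Matrix (Fin d) (Fin d) ℝ) :
    Matrix (Fin n × Fin d) (Fin n × Fin d) ℂ :=
  (1 - G.complexLaplacian) ⊗ₖ C.map Complex.ofReal - 1

/-- The right-hand side of the equation of the opinion dynamics. -/
noncomputable def opinionField (G : WeightedDigraph n) (C : Matrix (Fin d) (Fin d) ℝ)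
    (X : Fin n → EuclideanSpace ℝ (Fin d)) : Fin n → EuclideanSpace ℝ (Fin d) := fun i =>
  ∑ j ∈ G.neighbors i, G.adj i j • Matrix.toEuclideanLin C (X j - X i)
    + Matrix.toEuclideanLin (C - 1) (X i)

lemma kronecker_mulVec_apply {ι κ : Type*} [Fintype ι] [Fintype κ] (D : Matrix ι ι ℂ)
    (B : Matrix κ κ ℂ) (z : ι × κ → ℂ) (q : ι × κ) :
    ((D ⊗ₖ B) *ᵥ z) q = (B *ᵥ fun k => (D *ᵥ fun j => z (j, k)) q.1) q.2 := by
  simp only [mulVec, dotProduct, kroneckerMap_apply, Fintype.sum_prod_type, Finset.mul_sum]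
  rw [Finset.sum_comm]
  exact Finset.sum_congr rfl fun k _ => Finset.sum_congr rfl fun j _ => by ring

lemma sum_neighbors {V : Type*} [AddCommGroup V] [Module ℝ V] (G : WeightedDigraph n) (i : Fin n)
    (f : Fin n → V) :
    ∑ j ∈ G.neighbors i, G.adj i j • f j = ∑ j, G.adj i j • f j := by
  refine Finset.sum_subset (Finset.subset_univ _) fun j _ hj => ?_
  have h : G.adj i j = 0 := by
    by_contra hne
    refine hj ?_
    simp only [WeightedDigraph.neighbors, Finset.mem_filter, Finset.mem_univ, true_and]
    exact lt_of_le_of_ne (G.adj_nonneg i j) (Ne.symm hne)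
  rw [h, zero_smul]

lemma complexify_opinionField (G : WeightedDigraph n) (C : Matrix (Fin d) (Fin d) ℝ)
    (X : Fin n → EuclideanSpace ℝ (Fin d)) :
    complexify (opinionField G C X) = systemMatrix G C *ᵥ complexify X := by
  ext ⟨i, l⟩
  have h1 : opinionField G C X i =
      Matrix.toEuclideanLin C (X i - ∑ j, G.adj i j • (X i - X j)) - X i := by
    rw [opinionField, sum_neighbors G i fun j => Matrix.toEuclideanLin C (X j - X i)]
    simp only [← map_smul, ← map_sum]
    rw [map_sub (Matrix.toEuclideanLin (𝕜 := ℝ)), LinearMap.sub_apply, Matrix.toLpLin_one,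
      LinearMap.id_apply, ← add_sub_assoc, ← map_add]
    congr 2
    rw [sub_eq_add_neg, add_comm, ← Finset.sum_neg_distrib]
    congr 1
    refine Finset.sum_congr rfl fun j _ => ?_
    rw [← smul_neg, neg_sub]
  have h2 : ∀ k, ((1 - G.complexLaplacian) *ᵥ fun j => (complexify X (j, k))) i =
      ((X i - ∑ j, G.adj i j • (X i - X j)) k : ℝ) := by
    intro k
    rw [sub_mulVec, one_mulVec, Pi.sub_apply, WeightedDigraph.complexLaplacian_mulVec_apply]
    simp
  rw [systemMatrix, sub_mulVec, one_mulVec, Pi.sub_apply, kronecker_mulVec_apply]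
  simp only [h2]
  rw [complexify_apply, complexify_apply, h1]
  simp [Matrix.mulVec, dotProduct, Matrix.toLpLin_apply]

lemma rePart_systemMatrix_mulVec (G : WeightedDigraph n) (C : Matrix (Fin d) (Fin d) ℝ)
    (z : Fin n × Fin d → ℂ) :
    rePart (systemMatrix G C *ᵥ z) = opinionField G C (rePart z) := by
  have hz : z = complexify (rePart z) + Complex.I • complexify (rePart (-Complex.I • z)) := by
    ext q
    apply Complex.ext <;> simp
  have hI : ∀ X : Fin n → EuclideanSpace ℝ (Fin d), rePart (Complex.I • complexify X) = 0 := by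
    intro X; ext i l; simp
  conv_lhs => rw [hz]
  rw [mulVec_add, mulVec_smul, ← complexify_opinionField, ← complexify_opinionField, map_add, hI,
    add_zero, rePart_complexify]

lemma isModel1Solution_iff (G : WeightedDigraph n) (C : Matrix (Fin d) (Fin d) ℝ)
    (x : ℝ → Fin n → EuclideanSpace ℝ (Fin d)) :
    IsModel1Solution G C x ↔
      ∀ t, 0 ≤ t → HasDerivWithinAt x (opinionField G C (x t)) (Set.Ici 0) t := by
  simp only [IsModel1Solution, hasDerivWithinAt_pi, opinionField]

lemma IsModel1Solution.complexify_hasDerivWithinAt {G : WeightedDigraph n}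
    {C : Matrix (Fin d) (Fin d) ℝ} {x : ℝ → Fin n → EuclideanSpace ℝ (Fin d)}
    (hx : IsModel1Solution G C x) {t : ℝ} (ht : 0 ≤ t) :
    HasDerivWithinAt (fun t => complexify (x t)) (systemMatrix G C *ᵥ complexify (x t))
      (Set.Ici 0) t := by
  rw [← complexify_opinionField]
  exact (LinearMap.toContinuousLinearMap complexify).hasFDerivAt.comp_hasDerivWithinAt t
    ((isModel1Solution_iff G C x).1 hx t ht)

/-- The real part of `exp (s t) u` solves the equation when `u` is an eigenvector of the system
matrix for the eigenvalue `s`. -/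
lemma isModel1Solution_of_eigenvector {G : WeightedDigraph n} {C : Matrix (Fin d) (Fin d) ℝ}
    {s : ℂ} {u : Fin n × Fin d → ℂ} (hu : systemMatrix G C *ᵥ u = s • u) :
    IsModel1Solution G C (fun t => rePart (Complex.exp (s * t) • u)) := by
  rw [isModel1Solution_iff]
  intro t _
  rw [← rePart_systemMatrix_mulVec, mulVec_smul, hu, smul_smul]
  refine (LinearMap.toContinuousLinearMap rePart).hasFDerivAt.comp_hasDerivWithinAt t ?_
  have h1 : HasDerivAt (fun τ : ℝ => Complex.exp (s * τ)) (Complex.exp (s * t) * s) t := by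
    simpa using (((hasDerivAt_id (t : ℂ)).const_mul s).cexp).comp_ofReal
  exact (h1.smul_const u).hasDerivWithinAt

end Dynamics

/-! ### Consensus -/

section Consensus

lemma exists_norm_complexify_le {n d : ℕ} (G : WeightedDigraph n) (C : Matrix (Fin d) (Fin d) ℝ) :
    ∃ K, 0 ≤ K ∧ ∀ x : {x // IsModel1Solution G C x}, ‖complexify (x.1 0)‖ ≤ K * ‖x.1 0‖ :=
  ⟨‖LinearMap.toContinuousLinearMap (complexify (n := n) (d := d))‖, norm_nonneg _, fun x =>
    (LinearMap.toContinuousLinearMap complexify).le_opNorm (x.1 0)⟩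

variable {n d p : ℕ} [NeZero n] {G : WeightedDigraph n} {C : Matrix (Fin d) (Fin d) ℝ}
  {evL : Fin n → ℂ} {evC : Fin d → ℂ}

lemma mem_roots_iff_of_listsEigenvalues {m : ℕ} {M : Matrix (Fin m) (Fin m) ℝ} {ev : Fin m → ℂ}
    (hev : ListsEigenvalues M ev) {s : ℂ} :
    s ∈ (M.map Complex.ofReal).charpoly.roots ↔ ∃ k, ev k = s := by
  rw [← hev]; simp

lemma IsLogicMatrix.exists_eq_one (hC : IsLogicMatrix C p) (hevC : ListsEigenvalues C evC) :
    ∃ k, evC k = 1 := by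
  rw [← mem_roots_iff_of_listsEigenvalues hevC, ← Multiset.count_pos, Polynomial.count_roots,
    hC.algebraic_mult]
  exact hC.one_le

/-- Under the eigenvalue condition, the deviation `x - 𝟙 γᵀ x` from a weighted mean decays, for all
weights `γ` of sum `1`. The vector `L x` decays because it solves the same equation and is
annihilated by the product of the factors `L - λᵢ` over the other eigenvalues, and `1 - 𝟙 γᵀ` is a
left multiple of `L`. -/
lemma uniformExpDecay_deviation (hC : IsLogicMatrix C p)
    (hevL : ListsEigenvalues G.laplacian evL) (hevL0 : evL 0 = 0) (hevC : ListsEigenvalues C evC)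
    (hre : ∀ i : Fin n, i ≠ 0 → ∀ k : Fin d, ((1 - evL i) * evC k).re < 1)
    (γ : Fin n → ℂ) (hγ : ∑ j, γ j = 1) :
    UniformExpDecay (fun x : {x // IsModel1Solution G C x} => ‖x.1 0‖) (fun x t =>
      (((1 : Matrix (Fin n) (Fin n) ℂ) - vecMulVec 1 γ) ⊗ₖ (1 : Matrix (Fin d) (Fin d) ℂ)) *ᵥ
        complexify (x.1 t)) := by
  set L := G.complexLaplacian with hL
  set S := WeightedDigraph.otherEigenvalues evL with hS
  set B := C.map Complex.ofReal with hB
  have hLS : L * shiftProd L S = 0 := WeightedDigraph.complexLaplacian_mul_shiftProd hevL hevL0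
  have hS0 : ∀ s ∈ S, s ≠ 0 := by
    intro s hs
    obtain ⟨i, hi, rfl⟩ := WeightedDigraph.mem_otherEigenvalues.1 hs
    obtain ⟨k, hk⟩ := hC.exists_eq_one hevC
    intro h
    simpa [h, hk] using hre i hi k
  have hMN : ((1 - L) ⊗ₖ (1 : Matrix (Fin d) (Fin d) ℂ)) * ((1 : Matrix (Fin n) (Fin n) ℂ) ⊗ₖ B) =
      (1 - L) ⊗ₖ B := by
    rw [← mul_kronecker_mul, mul_one, one_mul]
  have hNM : ((1 : Matrix (Fin n) (Fin n) ℂ) ⊗ₖ B) * ((1 - L) ⊗ₖ (1 : Matrix (Fin d) (Fin d) ℂ)) =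
      (1 - L) ⊗ₖ B := by
    rw [← mul_kronecker_mul, mul_one, one_mul]
  have hdecay : UniformExpDecay (fun x : {x // IsModel1Solution G C x} => ‖x.1 0‖) (fun x t =>
      (L ⊗ₖ (1 : Matrix (Fin d) (Fin d) ℂ)) *ᵥ complexify (x.1 t)) := by
    refine UniformExpDecay.of_commute (fun _ => norm_nonneg _) (M := (1 - L) ⊗ₖ 1) (N := 1 ⊗ₖ B)
      (hMN.trans hNM.symm) (S.map fun s => 1 - s) B.charpoly.roots.toList ?_ ?_
      (exists_norm_mulVec_le _ (exists_norm_complexify_le G C)) (fun x t ht => ?_) ?_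
    · intro m hm μ hμ
      obtain ⟨s, hs, rfl⟩ := List.mem_map.1 hm
      obtain ⟨i, hi, rfl⟩ := WeightedDigraph.mem_otherEigenvalues.1 hs
      obtain ⟨k, rfl⟩ :=
        (mem_roots_iff_of_listsEigenvalues hevC).1 (Multiset.mem_toList.1 hμ)
      exact hre i hi k
    · rw [shiftProd_one_kronecker, shiftProd_charpoly_roots B (Multiset.coe_toList _),
        kronecker_zero]
    · refine ((x.2.complexify_hasDerivWithinAt ht).mulVec _).congr_deriv ?_
      rw [mulVec_mulVec, mulVec_mulVec, hMN, systemMatrix, mul_sub, sub_mul, mul_one, one_mul,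
        ← mul_kronecker_mul, ← mul_kronecker_mul, mul_sub, sub_mul, mul_one, one_mul, one_mul,
        mul_one]
    · have h1 := shiftProd_smul_sub L (-1) (-1) S
      have h2 : (-1 : ℂ) • L - algebraMap ℂ _ (-1) = 1 - L := by
        rw [map_neg, map_one, neg_smul, one_smul]; abel
      have h3 : (fun μ : ℂ => -1 * μ - -1) = fun s => 1 - s := by
        funext s; ring
      rw [h2, h3] at h1
      have h4 : shiftProd (1 - L) (S.map fun s => 1 - s) * L = 0 := by
        rw [h1, smul_mul_assoc, ← ((Commute.refl L).shiftProd_right S).eq, hLS, smul_zero]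
      refine (UniformExpDecay.zero _).congr fun x t _ => ?_
      rw [shiftProd_kronecker_one, mulVec_mulVec, ← mul_kronecker_mul, h4, zero_kronecker,
        zero_mulVec]
  obtain ⟨R, hR⟩ := exists_eq_mul_of_ker_le L (1 - vecMulVec 1 γ) S hS0 hLS fun v hv => by
    obtain ⟨c, rfl⟩ := WeightedDigraph.exists_eq_const_of_mulVec_eq_zero hevL hevL0 hS0 hv
    ext i
    rw [sub_mulVec, vecMulVec_mulVec]
    simp [dotProduct, ← Finset.sum_mul, hγ]
  refine (hdecay.mulVec (R ⊗ₖ (1 : Matrix (Fin d) (Fin d) ℂ))).congr fun x t _ => ?_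
  rw [mulVec_mulVec, ← mul_kronecker_mul, ← hR, mul_one]

lemma reachesConsensusExponentially_of_re_lt (hC : IsLogicMatrix C p)
    (hevL : ListsEigenvalues G.laplacian evL) (hevL0 : evL 0 = 0) (hevC : ListsEigenvalues C evC)
    (hre : ∀ i : Fin n, i ≠ 0 → ∀ k : Fin d, ((1 - evL i) * evC k).re < 1) :
    ReachesConsensusExponentially G C := by
  obtain ⟨K, α, hK, hα, h⟩ := (uniformExpDecay_deviation hC hevL hevL0 hevC hre (Pi.single 0 1)
    (by simp)).linearMap rePart
  have key : ∀ x, IsModel1Solution G C x → ∀ t, 0 ≤ t → ∀ i,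
      ‖x t i - x t 0‖ ≤ K * Real.exp (-α * t) * ‖x 0‖ := by
    intro x hx t ht i
    refine le_trans ?_ (h ⟨x, hx⟩ t ht)
    refine le_trans (le_of_eq ?_) (norm_le_pi_norm _ i)
    congr 1
    ext l
    beta_reduce
    rw [rePart_apply, kronecker_mulVec_apply, one_mulVec, sub_mulVec, vecMulVec_mulVec]
    simp
  refine ⟨2 * K, α, hα, fun x hx t ht i j => ?_⟩
  calc ‖x t i - x t j‖ = ‖(x t i - x t 0) - (x t j - x t 0)‖ := by rw [sub_sub_sub_cancel_right]
    _ ≤ K * Real.exp (-α * t) * ‖x 0‖ + K * Real.exp (-α * t) * ‖x 0‖ :=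
        (norm_sub_le _ _).trans (add_le_add (key x hx t ht i) (key x hx t ht j))
    _ = _ := by ring

/-- If consensus is reached exponentially, the eigenvalue condition holds: otherwise a nonconstant
eigenvector `v` of the Laplacian and an eigenvector `u` of `C` give, up to real parts, the solution
`exp (s t) v ⊗ u` with `s = (1 - λ) μ - 1` and `Re s ≥ 0`, for which the opinions of two individuals
do not approach each other. -/
lemma re_lt_of_reachesConsensusExponentially
    (hevL : ListsEigenvalues G.laplacian evL) (hevL0 : evL 0 = 0) (hevC : ListsEigenvalues C evC)
    (h : ReachesConsensusExponentially G C) (i : Fin n) (hi : i ≠ 0) (k : Fin d) :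
    ((1 - evL i) * evC k).re < 1 := by
  obtain ⟨K, α, hα, h⟩ := h
  obtain ⟨v, hv, a, b, hab⟩ := WeightedDigraph.exists_nonconstant_eigenvector hevL hevL0
    (WeightedDigraph.mem_otherEigenvalues.2 ⟨i, hi, rfl⟩)
  obtain ⟨u, hu⟩ : ∃ u, Module.End.HasEigenvector (C.map Complex.ofReal).toLin' (evC k) u := by
    refine Module.End.HasEigenvalue.exists_hasEigenvector ?_
    rw [Module.End.hasEigenvalue_iff_isRoot_charpoly, charpoly_toLin']
    exact Polynomial.isRoot_of_mem_roots ((mem_roots_iff_of_listsEigenvalues hevC).2 ⟨k, rfl⟩)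
  have hCu : C.map Complex.ofReal *ᵥ u = evC k • u := by simpa using hu.apply_eq_smul
  obtain ⟨l, hl⟩ := Function.ne_iff.1 hu.2
  set s := (1 - evL i) * evC k - 1 with hs
  set z : Fin n × Fin d → ℂ := fun q => v q.1 * u q.2 with hz
  have hTz : systemMatrix G C *ᵥ z = s • z := by
    ext ⟨j, m⟩
    have h1 : ∀ m', ((1 - G.complexLaplacian) *ᵥ fun j' => z (j', m')) j =
        ((1 - evL i) * v j) * u m' := by
      intro m'
      have : (fun j' => z (j', m')) = u m' • v := by
        ext j'; simp [hz, mul_comm]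
      rw [this, mulVec_smul, sub_mulVec, one_mulVec, hv]
      simp
      ring
    have h2 : (fun m' => ((1 - evL i) * v j) * u m') = ((1 - evL i) * v j) • u := rfl
    rw [systemMatrix, sub_mulVec, one_mulVec, Pi.sub_apply, kronecker_mulVec_apply]
    simp only [h1]
    rw [h2, mulVec_smul, hCu]
    simp [hz, hs]
    ring
  set δ := (v a - v b) * u l with hδ
  have hδ0 : δ ≠ 0 := mul_ne_zero (sub_ne_zero.2 hab) hl
  have hbound : ∀ c : ℂ, ∀ t : ℝ, 0 ≤ t → |(Complex.exp (s * t) * (c * δ)).re| ≤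
      K * Real.exp (-α * t) * ‖rePart (c • z)‖ := by
    intro c t ht
    have hsol := isModel1Solution_of_eigenvector (s := s) (u := c • z)
      (by rw [mulVec_smul, hTz, smul_comm])
    have h1 := h _ hsol t ht a b
    simp only [Complex.ofReal_zero, mul_zero, Complex.exp_zero, one_smul] at h1
    refine le_trans ?_ h1
    refine le_trans (le_of_eq ?_) (PiLp.norm_apply_le _ l)
    rw [PiLp.sub_apply, rePart_apply, rePart_apply, ← Complex.sub_re, Real.norm_eq_abs]
    congr 2
    simp only [Pi.smul_apply, smul_eq_mul, hz, hδ]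
    ring
  by_contra hcon
  have hs0 : 0 ≤ s.re := by
    rw [hs, Complex.sub_re, Complex.one_re]; linarith
  -- The choices `c = 1` and `c = -I` bound the real and the imaginary part of `exp (s t) δ`.
  set M := ‖rePart ((1 : ℂ) • z)‖ + ‖rePart (-Complex.I • z)‖ with hM
  have hle : ∀ t : ℝ, 0 ≤ t → ‖δ‖ ≤ K * M * Real.exp (-α * t) := by
    intro t ht
    have h1 := hbound 1 t ht
    have h2 := hbound (-Complex.I) t ht
    have h3 : (Complex.exp (s * t) * (-Complex.I * δ)).re = (Complex.exp (s * t) * δ).im := by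
      rw [mul_left_comm]; simp
    rw [h3] at h2
    rw [one_mul] at h1
    have h4 : (1 : ℝ) ≤ ‖Complex.exp (s * t)‖ := by
      rw [Complex.norm_exp]
      refine Real.one_le_exp ?_
      simpa using mul_nonneg hs0 ht
    calc ‖δ‖ ≤ ‖Complex.exp (s * t)‖ * ‖δ‖ := le_mul_of_one_le_left (norm_nonneg _) h4
      _ = ‖Complex.exp (s * t) * δ‖ := (norm_mul _ _).symm
      _ ≤ _ := Complex.norm_le_abs_re_add_abs_im _
      _ ≤ _ := add_le_add h1 h2
      _ = _ := by rw [hM]; ring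
  have hlim : Tendsto (fun t : ℝ => K * M * Real.exp (-α * t)) atTop (𝓝 0) := by
    simpa using (Real.tendsto_exp_comp_nhds_zero.2
      (tendsto_id.const_mul_atTop_of_neg (neg_neg_of_pos hα))).const_mul (K * M)
  have := ge_of_tendsto hlim ((eventually_ge_atTop 0).mono hle)
  exact hδ0 (norm_le_zero_iff.1 this)

/-! ### The limit -/

/-- Under the eigenvalue condition, the solutions converge exponentially to `(𝟙 γᵀ ⊗ P) x(0)`, where
`P` is the projector onto the eigenspace of `C` for the eigenvalue `1`: the quantity `(𝟙 γᵀ ⊗ P) x`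
is conserved, the deviation from the mean `𝟙 γᵀ x` decays, and so does `(𝟙 γᵀ ⊗ (1 - P)) x`, on which
the dynamics is that of `C - 1` without the eigenvalue `0`. -/
lemma uniformExpDecay_sub_limit (hC : IsLogicMatrix C p)
    (hevL : ListsEigenvalues G.laplacian evL) (hevL0 : evL 0 = 0) (hevC : ListsEigenvalues C evC)
    (hre : ∀ i : Fin n, i ≠ 0 → ∀ k : Fin d, ((1 - evL i) * evC k).re < 1)
    (γ : Fin n → ℂ) (hγL : γ ᵥ* G.complexLaplacian = 0) (hγ : ∑ j, γ j = 1)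
    (ζ ξ : Fin p → Fin d → ℂ) (hζ : ∀ r, C.map Complex.ofReal *ᵥ ζ r = ζ r)
    (hξ : ∀ r, ξ r ᵥ* C.map Complex.ofReal = ξ r)
    (hξζ : ∀ r s, ξ r ⬝ᵥ ζ s = if r = s then 1 else 0) :
    UniformExpDecay (fun x : {x // IsModel1Solution G C x} => ‖x.1 0‖) (fun x t =>
      complexify (x.1 t) -
        (vecMulVec 1 γ ⊗ₖ ∑ r, vecMulVec (ζ r) (ξ r)) *ᵥ complexify (x.1 0)) := by
  set L := G.complexLaplacian with hL
  set B := C.map Complex.ofReal with hB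
  set P := ∑ r, vecMulVec (ζ r) (ξ r) with hP
  set J : Matrix (Fin n) (Fin n) ℂ := vecMulVec 1 γ with hJ
  have hJL : J * (1 - L) = J := by
    rw [mul_sub, mul_one, hJ, vecMulVec_mul, hγL, vecMulVec_zero, sub_zero]
  have hPB : P * B = P := by
    rw [hP, Finset.sum_mul]
    exact Finset.sum_congr rfl fun r _ => by rw [vecMulVec_mul, hξ]
  have hBP : B * P = P := by
    rw [hP, Finset.mul_sum]
    exact Finset.sum_congr rfl fun r _ => by rw [mul_vecMulVec, hζ]
  set l := (B.charpoly.roots.filter (· ≠ 1)).toList with hl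
  have hQ : shiftProd B l * (1 - P) = 0 :=
    shiftProd_mul_one_sub_projector B 1 hC.algebraic_mult hC.geometric_mult ζ ξ
      (by simpa using hζ) hξζ (by simpa using hPB)
  have hcons : ∀ x, IsModel1Solution G C x → ∀ t, 0 ≤ t →
      (J ⊗ₖ P) *ᵥ complexify (x t) = (J ⊗ₖ P) *ᵥ complexify (x 0) := by
    intro x hx t ht
    have hder : ∀ τ : ℝ, 0 ≤ τ →
        HasDerivWithinAt (fun τ => (J ⊗ₖ P) *ᵥ complexify (x τ)) 0 (Set.Ici 0) τ := by
      intro τ hτ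
      refine ((hx.complexify_hasDerivWithinAt hτ).mulVec (J ⊗ₖ P)).congr_deriv ?_
      rw [mulVec_mulVec, systemMatrix, mul_sub, mul_one, ← mul_kronecker_mul, hJL, hPB, sub_self,
        zero_mulVec]
    refine constant_of_has_deriv_right_zero (a := 0) (b := t)
      (f := fun τ => (J ⊗ₖ P) *ᵥ complexify (x τ)) ?_ ?_ t ⟨ht, le_rfl⟩
    · exact fun τ hτ => (hder τ hτ.1).continuousWithinAt.mono Set.Icc_subset_Ici_self
    · exact fun τ hτ => (hder τ hτ.1).mono (Set.Ici_subset_Ici.2 hτ.1)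
  have hu : UniformExpDecay (fun x : {x // IsModel1Solution G C x} => ‖x.1 0‖) (fun x t =>
      (J ⊗ₖ (1 - P)) *ᵥ complexify (x.1 t)) := by
    refine UniformExpDecay.of_shiftProd_mulVec (fun _ => norm_nonneg _)
      ((1 : ℂ) • ((1 : Matrix (Fin n) (Fin n) ℂ) ⊗ₖ B) - algebraMap ℂ _ 1)
      (l.map fun μ => 1 * μ - 1) ?_ (UniformExpDecay.zero _)
      (exists_norm_mulVec_le _ (exists_norm_complexify_le G C)) (fun x t ht => ?_) ?_
    · intro s hs
      obtain ⟨μ, hμ, rfl⟩ := List.mem_map.1 hs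
      obtain ⟨h1, h2⟩ := Multiset.mem_filter.1 (Multiset.mem_toList.1 hμ)
      have := hC.re_lt_one μ h1 h2
      simpa using this
    · refine ((x.2.complexify_hasDerivWithinAt ht).mulVec _).congr_deriv ?_
      rw [add_zero, mulVec_mulVec, mulVec_mulVec, systemMatrix, one_smul, map_one, mul_sub, sub_mul,
        mul_one, one_mul, ← mul_kronecker_mul, ← mul_kronecker_mul, hJL, one_mul, mul_sub, sub_mul,
        hPB, hBP, mul_one, one_mul]
    · refine (UniformExpDecay.zero _).congr fun x t _ => ?_
      rw [shiftProd_smul_sub, one_pow, one_smul, shiftProd_one_kronecker, mulVec_mulVec,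
        ← mul_kronecker_mul, hQ, kronecker_zero, zero_mulVec]
  refine ((uniformExpDecay_deviation hC hevL hevL0 hevC hre γ hγ).add
    (fun _ => norm_nonneg _) hu).congr fun x t ht => ?_
  rw [← hcons x.1 x.2 t ht, ← add_mulVec, sub_kronecker, kronecker_sub, one_kronecker_one,
    sub_add_sub_cancel, sub_mulVec, one_mulVec]

end Consensus

theorem mainTheorem1 {n d p : ℕ} [NeZero n] (G : WeightedDigraph n)
    (C : Matrix (Fin d) (Fin d) ℝ) (hC : IsLogicMatrix C p)
    (evL : Fin n → ℂ) (hevL : ListsEigenvalues G.laplacian evL) (hevL0 : evL 0 = 0)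
    (evC : Fin d → ℂ) (hevC : ListsEigenvalues C evC) :
    (ReachesConsensusExponentially G C ↔
      ∀ i : Fin n, i ≠ 0 → ∀ k : Fin d, ((1 - evL i) * evC k).re < 1) ∧
    ((∀ i : Fin n, i ≠ 0 → ∀ k : Fin d, ((1 - evL i) * evC k).re < 1) →
      ∀ (γ : Fin n → ℝ), Matrix.vecMul γ G.laplacian = 0 → ∑ j, γ j = 1 →
      ∀ (ζ ξ : Fin p → Fin d → ℝ),
        (∀ r, Matrix.mulVec C (ζ r) = ζ r) → (∀ r, Matrix.vecMul (ξ r) C = ξ r) →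
        (∀ r s, dotProduct (ξ r) (ζ s) = if r = s then 1 else 0) →
      (∀ x, IsModel1Solution G C x → ∀ i, Tendsto (fun t => x t i) atTop
        (𝓝 (Matrix.toEuclideanLin (∑ r, Matrix.vecMulVec (ζ r) (ξ r)) (∑ j, γ j • x 0 j)))) ∧
      ∃ K α : ℝ, 0 < α ∧ ∀ x, IsModel1Solution G C x → ∀ t, 0 ≤ t → ∀ i,
        ‖x t i - Matrix.toEuclideanLin (∑ r, Matrix.vecMulVec (ζ r) (ξ r)) (∑ j, γ j • x 0 j)‖
          ≤ K * Real.exp (-α * t) * ‖x 0‖) := by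
  refine ⟨⟨re_lt_of_reachesConsensusExponentially hevL hevL0 hevC,
    reachesConsensusExponentially_of_re_lt hC hevL hevL0 hevC⟩, ?_⟩
  intro hre γ hγL hγ ζ ξ hζ hξ hξζ
  have hγL' : (fun j => (γ j : ℂ)) ᵥ* G.complexLaplacian = 0 := by
    ext j
    have := congrArg Complex.ofReal (congrFun hγL j)
    simpa [vecMul, dotProduct, WeightedDigraph.complexLaplacian] using this
  have hγ' : ∑ j, (γ j : ℂ) = 1 := by exact_mod_cast hγ
  have hζ' : ∀ r, C.map Complex.ofReal *ᵥ (fun l => (ζ r l : ℂ)) = fun l => (ζ r l : ℂ) := by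
    intro r
    ext l
    have := congrArg Complex.ofReal (congrFun (hζ r) l)
    simpa [mulVec, dotProduct] using this
  have hξ' : ∀ r, (fun l => (ξ r l : ℂ)) ᵥ* C.map Complex.ofReal = fun l => (ξ r l : ℂ) := by
    intro r
    ext l
    have := congrArg Complex.ofReal (congrFun (hξ r) l)
    simpa [vecMul, dotProduct] using this
  have hξζ' : ∀ r s, (fun l => (ξ r l : ℂ)) ⬝ᵥ (fun l => (ζ s l : ℂ)) = if r = s then 1 else 0 := by
    intro r s
    have := congrArg Complex.ofReal (hξζ r s)
    simpa [dotProduct, apply_ite Complex.ofReal] using this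
  obtain ⟨K, α, hK, hα, h⟩ := (uniformExpDecay_sub_limit hC hevL hevL0 hevC hre _ hγL' hγ' _ _ hζ'
    hξ' hξζ').linearMap rePart
  have key : ∀ x, IsModel1Solution G C x → ∀ t, 0 ≤ t → ∀ i,
      ‖x t i - Matrix.toEuclideanLin (∑ r, Matrix.vecMulVec (ζ r) (ξ r)) (∑ j, γ j • x 0 j)‖
        ≤ K * Real.exp (-α * t) * ‖x 0‖ := by
    intro x hx t ht i
    refine le_trans ?_ (h ⟨x, hx⟩ t ht)
    refine le_trans (le_of_eq ?_) (norm_le_pi_norm _ i)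
    congr 1
    ext l
    beta_reduce
    rw [map_sub, rePart_complexify, Pi.sub_apply, PiLp.sub_apply, PiLp.sub_apply]
    congr 1
    rw [rePart_apply, kronecker_mulVec_apply, ← Complex.ofReal_re
      (Matrix.toEuclideanLin (∑ r, Matrix.vecMulVec (ζ r) (ξ r)) (∑ j, γ j • x 0 j) l)]
    congr 1
    have hmean : ∀ k, (vecMulVec 1 (fun j => (γ j : ℂ)) *ᵥ fun j => complexify (x 0) (j, k)) i =
        (((∑ j, γ j • x 0 j) k : ℝ) : ℂ) := by
      intro k
      rw [vecMulVec_mulVec]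
      simp [dotProduct]
    simp only [hmean]
    generalize ∑ j, γ j • x 0 j = m
    simp only [Matrix.toLpLin_apply, mulVec, dotProduct, vecMulVec, Matrix.sum_apply, of_apply,
      Complex.ofReal_sum, Complex.ofReal_mul]
  refine ⟨fun x hx i => ?_, K, α, hα, key⟩
  rw [tendsto_iff_norm_sub_tendsto_zero]
  have hlim : Tendsto (fun t : ℝ => K * Real.exp (-α * t) * ‖x 0‖) atTop (𝓝 0) := by
    simpa using ((Real.tendsto_exp_comp_nhds_zero.2
      (tendsto_id.const_mul_atTop_of_neg (neg_neg_of_pos hα))).const_mul K).mul_const ‖x 0‖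
  exact squeeze_zero' (Eventually.of_forall fun t => norm_nonneg _)
    ((eventually_ge_atTop 0).mono fun t ht => key x hx t ht i) hlim
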